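/- Consider tabular episodic MDPs $(\mathcal S,\mathcal A,P,r,H,\rho)$ with finite state and action sets, horizon $H$, initial distribution $\rho$, transitions $P_h(\cdot\mid s,a)$ and rewards $r_h(s,a)\in[0,1]$ for $h=1,\dots,H$. For a non-stationary stochastic policy $\pi=(\pi_h(\cdot\mid s))_{h,s}$ let $d_h^\pi(s,a)=\mathbb P(s_h=s,a_h=a)$ and let $V(\pi)=\mathbb E\big[\sum_{h=1}^H r_h(s_h,a_h)\big]$. Given $N$ independent trajectories of an expert policy $\pi^{\mathrm E}$, let $\widehat d_h(s,a)$ be the fraction of the trajectories with $(s_h,a_h)=(s,a)$. TV-AIL minimizes $$\sum_{h=1}^H\sum_{(s,a)\in\mathcal S\times\mathcal A}\big|d_h^\pi(s,a)-\widehat d_h(s,a)\big|$$ over all policies $\pi$, viewed as points of $\mathbb R^{H|\mathcal S||\mathcal A|}$; it outputs $\pi^{\mathrm{AIL}}$ drawn from the uniform distribution on the set of all minimizers, i.e. from normalized Hausdorff measure in the dimension of that set. An MDP with an expert policy has isolated absorbing states if $P_h(s\mid s,a)=1$ for all $h,s,a$, and there is an action $a^1$ that the expert plays with probability $1$ at every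 step and state, with $r_h(s,a^1)=1$ and $r_h(s,a)=0$ for all $h$, $s$ and $a\neq a^1$. **Proposition.** There is an absolute constant $c>0$ such that, for all finite sets $\mathcal S,\mathcal A$ with $|\mathcal S|\ge 2$ and $|\mathcal A|\ge 2$ and every $H\ge 1$, there is a tabular episodic MDP on $\mathcal S,\mathcal A$ with horizon $H$ and an expert policy $\pi^{\mathrm E}$, with isolated absorbing states, such that for every $N\ge 1$ the uniform distribution on the set of minimizers is a well-defined probability measure that integrates $V$ (whatever the dataset), and $$V(\pi^{\mathrm E})-\mathbb E\big[V(\pi^{\mathrm{AIL}})\big]\;\ge\; c\,\min\Big\{H,\;H\sqrt{|\mathcal S|/N}\Big\},$$ where the expectation is over the $N$ expert trajectories and the uniform choice of $\pi^{\mathrm{AIL}}$. -/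

import Mathlib

open MeasureTheory

noncomputable section

namespace ImitationLearning

/-- A tabular episodic Markov decision process with horizon `H`. The time steps `1, …, H` are
indexed by `Fin H`, starting from `0`. -/
structure EpisodicMDP (S A : Type*) [Fintype S] (H : ℕ) where
  /-- The initial state distribution. -/
  ρ : S → ℝ
  ρ_mem : ρ ∈ stdSimplex ℝ S
  /-- `P h s a s'` is the probability of moving from `s` to `s'` under action `a` at step `h`. -/
  P : Fin H → S → A → S → ℝ
  P_mem : ∀ h s a, P h s a ∈ stdSimplex ℝ S
  /-- The reward function. -/
  r : Fin H → S → A → ℝ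
  r_mem : ∀ h s a, r h s a ∈ Set.Icc (0 : ℝ) 1

/-- A trajectory `(s_1, a_1, …, s_H, a_H)`. -/
abbrev Trajectory (S A : Type*) (H : ℕ) : Type _ := Fin H → S × A

/-- The Euclidean space that contains the non-stationary stochastic policies; the coordinate
`π (h, s, a)` is the probability `π_h (a | s)`. -/
abbrev PolicySpace (S A : Type*) (H : ℕ) : Type _ := EuclideanSpace ℝ (Fin H × S × A)

/-- The set `Π` of all non-stationary stochastic policies. -/
def policies (S A : Type*) [Fintype A] (H : ℕ) : Set (PolicySpace S A H) :=
  {π | ∀ h s, (fun a => π (h, s, a)) ∈ stdSimplex ℝ A}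

/-- Normalized Hausdorff measure on `K`, in the dimension of `K`. If `K` is a nonempty compact
convex set, this is normalized Lebesgue measure of the affine hull of `K`, restricted to `K`. -/
def uniformMeasure {E : Type*} [EMetricSpace E] [MeasurableSpace E] [BorelSpace E]
    (K : Set E) : Measure E :=
  ProbabilityTheory.cond (Measure.hausdorffMeasure (dimH K).toReal) K

namespace EpisodicMDP

variable {S A : Type*} [Fintype S] {H : ℕ}

/-- The probability of a trajectory under a policy:
`ρ(s_1) π_1(a_1|s_1) ∏_{h=1}^{H-1} P_h(s_{h+1}|s_h,a_h) π_{h+1}(a_{h+1}|s_{h+1})`. -/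
def trajProb (M : EpisodicMDP S A H) (π : PolicySpace S A H) (tr : Trajectory S A H) : ℝ :=
  ∏ h : Fin H,
    (if (h : ℕ) = 0 then M.ρ (tr h).1
      else
        let k : Fin H := ⟨(h : ℕ) - 1, by omega⟩
        M.P k (tr k).1 (tr k).2 (tr h).1) *
    π (h, (tr h).1, (tr h).2)

/-- The policy value `V(π)`, the expected total reward of an episode. -/
def value [Fintype A] (M : EpisodicMDP S A H) (π : PolicySpace S A H) : ℝ :=
  ∑ tr : Trajectory S A H, M.trajProb π tr * ∑ h, M.r h (tr h).1 (tr h).2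

/-- The state-action distribution `d_h^π(s, a)`, the probability that `s_h = s` and `a_h = a`. -/
def occupancy [Fintype A] [DecidableEq S] [DecidableEq A]
    (M : EpisodicMDP S A H) (π : PolicySpace S A H) (h : Fin H) (s : S) (a : A) : ℝ :=
  ∑ tr : Trajectory S A H, if tr h = (s, a) then M.trajProb π tr else 0

end EpisodicMDP

/-- The empirical state-action distribution at step `h` of a dataset of `N` trajectories. -/
def empirical {S A : Type*} [DecidableEq S] [DecidableEq A] {H N : ℕ}
    (D : Fin N → Trajectory S A H) (h : Fin H) (s : S) (a : A) : ℝ :=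
  ((Finset.univ.filter fun i => D i h = (s, a)).card : ℝ) / N

namespace EpisodicMDP

variable {S A : Type*} [Fintype S] [Fintype A] [DecidableEq S] [DecidableEq A] {H N : ℕ}

/-- The objective of TV-AIL: the sum over the steps of the `ℓ¹` distance between the
state-action distribution of the policy and the empirical one. -/
def tvLoss (M : EpisodicMDP S A H) (D : Fin N → Trajectory S A H) (π : PolicySpace S A H) : ℝ :=
  ∑ h, ∑ s, ∑ a, |M.occupancy π h s a - empirical D h s a|

/-- The set of optimal solutions of TV-AIL on the dataset `D`. -/
def tvAIL (M : EpisodicMDP S A H) (D : Fin N → Trajectory S A H) : Set (PolicySpace S A H) :=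
  {π | π ∈ policies S A H ∧ ∀ π' ∈ policies S A H, M.tvLoss D π ≤ M.tvLoss D π'}

/-- The law of the output of TV-AIL on the dataset `D`, with ties broken uniformly. -/
def tvAILLaw (M : EpisodicMDP S A H) (D : Fin N → Trajectory S A H) :
    Measure (PolicySpace S A H) :=
  uniformMeasure (M.tvAIL D)

/-- The expected value `E[V(π^AIL)]`: the dataset consists of `N` independent trajectories of
the expert `πE`, and the output is then drawn uniformly from the optimal solutions. -/
def expectedAILValue (M : EpisodicMDP S A H) (πE : PolicySpace S A H) (N : ℕ) : ℝ :=
  ∑ D : Fin N → Trajectory S A H,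
    (∏ i, M.trajProb πE (D i)) * ∫ π, M.value π ∂(M.tvAILLaw D)

end EpisodicMDP

/-- MDPs with isolated absorbing states: every action keeps every state in place, and there is
an action `a₁` that the expert plays in all states and steps, with reward `1`, whereas all
other actions have reward `0`. -/
def IsolatedAbsorbing {S A : Type*} [Fintype S] {H : ℕ}
    (M : EpisodicMDP S A H) (πE : PolicySpace S A H) : Prop :=
  (∀ h s a, M.P h s a s = 1) ∧
  ∃ a₁ : A, ∀ h s, πE (h, s, a₁) = 1 ∧ M.r h s a₁ = 1 ∧ ∀ a, a ≠ a₁ → M.r h s a = 0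

end ImitationLearning

end

/-! The hard instance has a uniform initial distribution, states that are never left, and an expert
that always plays `a₁`. Its occupancies are `ρ(s) π_h(a|s)`, so the loss splits over pairs `(h, s)`.
With `x = π_h(a₁|s)` and `q` the empirical frequency of `s`, each summand is `|ρ x - q| + ρ (1 -
x)`. It is constant for `x ≥ q/ρ`: in an undersampled state TV-AIL cannot tell the expert from a
policy that plays `a₁` with probability only `q/ρ`. The minimizers are therefore exactly the
policies with `x ≥ t = min(q/ρ, 1)` (`tvAIL_eq`).

This set is compact and convex, hence has a uniform law. Exchanging the masses of `a₁` and another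
action `a₂`, up to a shift by `t`, is an isometry that preserves the set. By this symmetry the mean
of `x` is at most `(1 + t)/2` (`integral_uniformMeasure_thresholdPolicies_le`), and each `(h, s)`
costs at least `(ρ - q)⁺/2` in value.

Averaging over the data turns `(ρ - q)⁺` into half of `|q - ρ|`, because `q` is unbiased
(`expectedAILValue_le`). The mean absolute deviation is bounded below through second and fourth
moments (`le_sum_prod_weight_mul_abs_sum`), and summing over states gives the rate. -/

namespace ImitationLearning

/-! ### Uniform distributions on compact convex sets -/

section UniformMeasure

variable {E : Type*} [NormedAddCommGroup E] [NormedSpace ℝ E] [FiniteDimensional ℝ E]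
  [MeasurableSpace E] [BorelSpace E]

/-- A compact set with nonempty interior has positive and finite Hausdorff measure in its
Hausdorff dimension. -/
lemma hausdorffMeasure_dimH_pos_lt_top_of_interior {K : Set E} (hK : IsCompact K)
    (hi : (interior K).Nonempty) :
    Measure.hausdorffMeasure (dimH K).toReal K ≠ 0 ∧
      Measure.hausdorffMeasure (dimH K).toReal K ≠ ⊤ := by
  have hd : dimH K = Module.finrank ℝ E := Real.dimH_of_nonempty_interior hi
  have : (dimH K).toReal = (Module.finrank ℝ E : ℝ) := by rw [hd]; simp
  rw [this]
  -- In the full dimension Hausdorff measure is a Haar measure: positive on nonempty open sets,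
  -- finite on compact ones.
  exact ⟨fun h => (isOpen_interior.measure_pos _ hi).ne' (measure_mono_null interior_subset h),
    hK.measure_lt_top.ne⟩

/-- A nonempty compact convex set has positive and finite Hausdorff measure in its Hausdorff
dimension. -/
lemma hausdorffMeasure_dimH_pos_lt_top {K : Set E} (hK : IsCompact K) (hc : Convex ℝ K)
    (hne : K.Nonempty) :
    Measure.hausdorffMeasure (dimH K).toReal K ≠ 0 ∧
      Measure.hausdorffMeasure (dimH K).toReal K ≠ ⊤ := by
  -- A convex set has an interior point relative to its affine span. Using that point as origin
  -- identifies the span isometrically with a vector space in which the interior is nonempty.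
  obtain ⟨_, y, hy, -⟩ := hne.intrinsicInterior hc
  have : Nonempty (affineSpan ℝ K) := ⟨y⟩
  let e : (affineSpan ℝ K).direction ≃ᵢ affineSpan ℝ K := IsometryEquiv.vaddConst y
  let f : (affineSpan ℝ K).direction → E := fun v => e v
  have hf : Isometry f := isometry_subtype_coe.comp e.isometry
  have himg : f '' (f ⁻¹' K) = K := by
    refine Set.image_preimage_eq_of_subset fun x hx => ?_
    exact ⟨e.symm ⟨x, subset_affineSpan ℝ K hx⟩, by simp [f]⟩
  have hcomp : IsCompact (f ⁻¹' K) := hf.isClosedEmbedding.isCompact_preimage hK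
  have hint : (interior (f ⁻¹' K)).Nonempty := by
    refine ⟨e.symm y, ?_⟩
    have : f ⁻¹' K = e ⁻¹' ((↑) ⁻¹' K) := rfl
    rw [this, ← e.coe_toHomeomorph, ← e.toHomeomorph.preimage_interior]
    simpa using hy
  have h := hausdorffMeasure_dimH_pos_lt_top_of_interior hcomp hint
  rw [← hf.dimH_image, ← hf.hausdorffMeasure_image (Or.inl ENNReal.toReal_nonneg), himg] at h
  exact h

lemma isProbabilityMeasure_uniformMeasure {K : Set E} (hK : IsCompact K) (hc : Convex ℝ K)
    (hne : K.Nonempty) : IsProbabilityMeasure (uniformMeasure K) :=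
  have h := hausdorffMeasure_dimH_pos_lt_top hK hc hne
  ProbabilityTheory.cond_isProbabilityMeasure_of_finite h.1 h.2

lemma integrable_uniformMeasure {K : Set E} (hK : IsCompact K) (hc : Convex ℝ K)
    (hne : K.Nonempty) {f : E → ℝ} (hf : Continuous f) : Integrable f (uniformMeasure K) := by
  have := isProbabilityMeasure_uniformMeasure hK hc hne
  obtain ⟨C, hC⟩ := hK.exists_bound_of_continuousOn hf.continuousOn
  refine Integrable.of_bound hf.aestronglyMeasurable C ?_
  filter_upwards [ProbabilityTheory.ae_cond_mem hK.measurableSet] with x hx using hC x hx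

/-- An isometry that preserves `K` preserves the uniform distribution on `K`. -/
lemma measurePreserving_uniformMeasure {F : Type*} [EMetricSpace F] [MeasurableSpace F]
    [BorelSpace F] {K : Set F} (hK : MeasurableSet K) (e : F ≃ᵢ F) (he : e ⁻¹' K = K) :
    MeasurePreserving e (uniformMeasure K) (uniformMeasure K) := by
  have h := (e.measurePreserving_hausdorffMeasure (dimH K).toReal).restrict_preimage hK
  rw [he] at h
  exact h.smul_measure _

end UniformMeasure

/-! ### Policies, and MDPs whose states are never left -/

lemma isCompact_policies (S A : Type*) [Fintype S] [Fintype A] (H : ℕ) :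
    IsCompact (policies S A H) := by
  have h : IsCompact {x : Fin H × S × A → ℝ | ∀ p : Fin H × S,
      (fun a => x (p.1, p.2, a)) ∈ stdSimplex ℝ A} := by
    refine (isCompact_univ_pi fun _ => isCompact_Icc (a := (0 : ℝ)) (b := 1)).of_isClosed_subset
      ?_ ?_
    · simp only [Set.ofPred_forall]
      exact isClosed_iInter fun p => (isClosed_stdSimplex ℝ A).preimage (by fun_prop)
    · rintro x hx ⟨h, s, a⟩ -
      exact mem_Icc_of_mem_stdSimplex (hx (h, s)) a
  have :=
    (EuclideanSpace.equiv (Fin H × S × A) ℝ).toHomeomorph.isClosedEmbedding.isCompact_preimage h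
  convert this using 1
  ext π
  simp [policies]

lemma convex_policies (S A : Type*) [Fintype A] (H : ℕ) : Convex ℝ (policies S A H) := by
  intro x hx y hy a b ha hb hab h s
  exact convex_stdSimplex ℝ A (hx h s) (hy h s) ha hb hab

namespace EpisodicMDP

variable {S A : Type*} [Fintype S] {H : ℕ}

lemma continuous_trajProb (M : EpisodicMDP S A H) (tr : Trajectory S A H) :
    Continuous fun π : PolicySpace S A H => M.trajProb π tr := by
  unfold trajProb
  fun_prop

lemma continuous_value [Fintype A] (M : EpisodicMDP S A H) : Continuous M.value := by
  unfold value
  exact continuous_finsetSum _ fun tr _ => (M.continuous_trajProb tr).mul_const _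

lemma trajProb_nonneg [Fintype A] (M : EpisodicMDP S A H) {π : PolicySpace S A H}
    (hπ : π ∈ policies S A H) (tr : Trajectory S A H) : 0 ≤ M.trajProb π tr := by
  refine Finset.prod_nonneg fun h _ => mul_nonneg ?_ ((hπ _ _).1 _)
  split_ifs
  · exact M.ρ_mem.1 _
  · exact (M.P_mem _ _ _).1 _

variable [DecidableEq S]

lemma transition_eq {M : EpisodicMDP S A H} (hP : ∀ h s a, M.P h s a s = 1) (h : Fin H) (s : S)
    (a : A) (s' : S) : M.P h s a s' = if s' = s then 1 else 0 := by
  split_ifs with hs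
  · rw [hs, hP]
  · have h1 := (M.P_mem h s a).2
    rw [← Finset.add_sum_erase _ _ (Finset.mem_univ s), hP] at h1
    have h2 : ∑ x ∈ Finset.univ.erase s, M.P h s a x = 0 := by linarith
    exact (Finset.sum_eq_zero_iff_of_nonneg fun x _ => (M.P_mem h s a).1 x).1 h2 s' (by simp [hs])

/-- With absorbing states, a trajectory stays in its initial state. -/
lemma trajProb_eq {M : EpisodicMDP S A H} (hP : ∀ h s a, M.P h s a s = 1) (hH : 0 < H)
    (π : PolicySpace S A H) (tr : Trajectory S A H) :
    M.trajProb π tr =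
      ∑ s, M.ρ s * ∏ h, if (tr h).1 = s then π (h, s, (tr h).2) else 0 := by
  obtain ⟨k, rfl⟩ : ∃ k, H = k + 1 := ⟨H - 1, by omega⟩
  by_cases hc : ∀ h, (tr h).1 = (tr 0).1
  · rw [Finset.sum_eq_single (tr 0).1]
    · simp only [trajProb, Finset.prod_mul_distrib]
      rw [Fin.prod_univ_succ]
      simp [hc, hP]
    · intro s _ hs
      rw [Finset.prod_eq_zero (Finset.mem_univ 0) (by simp [hs.symm]), mul_zero]
    · simp
  -- Both sides vanish on a path that changes state: a nonzero left side would force every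
  -- transition to be stationary, and on the right each `s` disagrees with the path somewhere.
  · rw [Finset.sum_eq_zero]
    · by_contra hne
      refine hc fun h => ?_
      replace hne := Finset.prod_ne_zero_iff.1 hne
      induction h using Fin.induction with
      | zero => rfl
      | succ i ih =>
        have h1 := left_ne_zero_of_mul (hne i.succ (Finset.mem_univ _))
        rw [if_neg (by simp), transition_eq hP] at h1
        have h2 : (tr i.succ).1 = (tr i.castSucc).1 := by
          by_contra h3
          exact h1 (if_neg h3)
        rw [h2, ih]
    · intro s _
      push Not at hc
      obtain ⟨h, hh⟩ := hc
      refine mul_eq_zero_of_right _ (Finset.prod_eq_zero_iff.2 ?_)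
      by_cases h0 : (tr 0).1 = s
      · exact ⟨h, Finset.mem_univ _, if_neg (h0 ▸ hh)⟩
      · exact ⟨0, Finset.mem_univ _, if_neg h0⟩

lemma fst_eq_of_trajProb_ne_zero {M : EpisodicMDP S A H} (hP : ∀ h s a, M.P h s a s = 1)
    {π : PolicySpace S A H} {tr : Trajectory S A H} (htr : M.trajProb π tr ≠ 0) (h k : Fin H) :
    (tr h).1 = (tr k).1 := by
  rw [trajProb_eq hP (h.pos)] at htr
  obtain ⟨s, -, hs⟩ := Finset.exists_ne_zero_of_sum_ne_zero htr
  have key := fun h => Finset.prod_ne_zero_iff.1 (right_ne_zero_of_mul hs) h (Finset.mem_univ _)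
  rw [of_not_not fun hh => key h (if_neg hh), of_not_not fun hh => key k (if_neg hh)]

variable [Fintype A]

/-- The expectation of a function of the state and the action at step `h`. -/
lemma sum_trajProb_mul {M : EpisodicMDP S A H} (hP : ∀ h s a, M.P h s a s = 1)
    {π : PolicySpace S A H} (hπ : π ∈ policies S A H) (h : Fin H) (g : S × A → ℝ) :
    ∑ tr : Trajectory S A H, M.trajProb π tr * g (tr h) =
      ∑ s, M.ρ s * ∑ a, π (h, s, a) * g (s, a) := by
  classical
  simp only [trajProb_eq hP h.pos, Finset.sum_mul, mul_assoc]
  rw [Finset.sum_comm]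
  refine Finset.sum_congr rfl fun s _ => ?_
  rw [← Finset.mul_sum]
  congr 1
  -- Absorbing `g` into the factor of step `h` makes the summand a product over steps, so the sum
  -- over trajectories factors.
  let φ : Fin H → S × A → ℝ := fun k x =>
    (if x.1 = s then π (k, s, x.2) else 0) * if k = h then g x else 1
  have h1 : ∀ tr : Trajectory S A H,
      (∏ k, if (tr k).1 = s then π (k, s, (tr k).2) else 0) * g (tr h) = ∏ k, φ k (tr k) := by
    intro tr
    simp only [φ]
    rw [Finset.prod_mul_distrib]
    simp
  have h2 : ∀ k, ∑ x, φ k x = if k = h then ∑ a, π (h, s, a) * g (s, a) else 1 := by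
    intro k
    rw [Fintype.sum_prod_type, Finset.sum_eq_single s (by simp +contextual [φ]) (by simp)]
    by_cases hk : k = h
    · subst hk
      simp [φ]
    · simpa [φ, hk] using (hπ k s).2
  rw [Finset.sum_congr rfl fun tr _ => h1 tr]
  have h3 := Finset.prod_univ_sum (fun _ : Fin H => (Finset.univ : Finset (S × A))) φ
  rw [Fintype.piFinset_univ] at h3
  rw [← h3, Finset.prod_congr rfl fun k _ => h2 k]
  simp

lemma sum_trajProb {M : EpisodicMDP S A H} (hP : ∀ h s a, M.P h s a s = 1) (hH : 0 < H)
    {π : PolicySpace S A H} (hπ : π ∈ policies S A H) :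
    ∑ tr : Trajectory S A H, M.trajProb π tr = 1 := by
  have h := sum_trajProb_mul hP hπ ⟨0, hH⟩ fun _ => 1
  simpa [(hπ _ _).2, M.ρ_mem.2] using h

lemma value_eq {M : EpisodicMDP S A H} (hP : ∀ h s a, M.P h s a s = 1)
    {π : PolicySpace S A H} (hπ : π ∈ policies S A H) :
    M.value π = ∑ h, ∑ s, M.ρ s * ∑ a, π (h, s, a) * M.r h s a := by
  simp only [value, Finset.mul_sum]
  rw [Finset.sum_comm]
  refine Finset.sum_congr rfl fun h _ => ?_
  simpa [Finset.mul_sum] using sum_trajProb_mul hP hπ h fun x => M.r h x.1 x.2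

variable [DecidableEq A] {N : ℕ}

lemma occupancy_eq {M : EpisodicMDP S A H} (hP : ∀ h s a, M.P h s a s = 1)
    {π : PolicySpace S A H} (hπ : π ∈ policies S A H) (h : Fin H) (s : S) (a : A) :
    M.occupancy π h s a = M.ρ s * π (h, s, a) := by
  have := sum_trajProb_mul hP hπ h fun x => if x = (s, a) then 1 else 0
  simp only [mul_ite, mul_one, mul_zero] at this
  rw [occupancy, this, Finset.sum_eq_single s]
  · simp
  · intro s' _ hs
    simp [hs]
  · simp

lemma continuous_tvLoss (M : EpisodicMDP S A H) (D : Fin N → Trajectory S A H) :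
    Continuous (M.tvLoss D) := by
  unfold tvLoss occupancy
  refine continuous_finsetSum _ fun h _ => continuous_finsetSum _ fun s _ =>
    continuous_finsetSum _ fun a _ => (Continuous.sub ?_ continuous_const).abs
  refine continuous_finsetSum _ fun tr _ => ?_
  split_ifs
  · exact M.continuous_trajProb tr
  · exact continuous_const

/-- Because states are never left, occupancies are linear in the policy; for general transitions
they involve products of policy entries at different steps. -/
lemma convexOn_tvLoss {M : EpisodicMDP S A H} (hP : ∀ h s a, M.P h s a s = 1)
    (D : Fin N → Trajectory S A H) : ConvexOn ℝ (policies S A H) (M.tvLoss D) := by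
  refine ⟨convex_policies S A H, fun x hx y hy a b ha hb hab => ?_⟩
  simp only [tvLoss, smul_eq_mul, Finset.mul_sum, ← Finset.sum_add_distrib]
  refine Finset.sum_le_sum fun h _ => Finset.sum_le_sum fun s _ => Finset.sum_le_sum fun c _ => ?_
  rw [occupancy_eq hP hx, occupancy_eq hP hy,
    occupancy_eq hP (convex_policies S A H hx hy ha hb hab), ← abs_of_nonneg ha,
    ← abs_of_nonneg hb, ← abs_mul, ← abs_mul, abs_of_nonneg ha, abs_of_nonneg hb]
  refine le_trans (le_of_eq ?_) (abs_add_le _ _)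
  congr 1
  simp only [PiLp.add_apply, PiLp.smul_apply, smul_eq_mul]
  linear_combination empirical D h s c * hab

lemma isCompact_tvAIL (M : EpisodicMDP S A H) (D : Fin N → Trajectory S A H) :
    IsCompact (M.tvAIL D) := by
  have : M.tvAIL D = policies S A H ∩ {π | ∀ π' ∈ policies S A H, M.tvLoss D π ≤ M.tvLoss D π'} :=
    rfl
  rw [this]
  refine (isCompact_policies S A H).inter_right ?_
  simp only [Set.ofPred_forall]
  exact isClosed_biInter fun π' _ => isClosed_le (M.continuous_tvLoss D) continuous_const

lemma nonempty_tvAIL (M : EpisodicMDP S A H) (D : Fin N → Trajectory S A H)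
    (hne : (policies S A H).Nonempty) : (M.tvAIL D).Nonempty := by
  obtain ⟨π, hπ, hmin⟩ :=
    (isCompact_policies S A H).exists_isMinOn hne (M.continuous_tvLoss D).continuousOn
  exact ⟨π, hπ, fun π' hπ' => hmin hπ'⟩

lemma convex_tvAIL {M : EpisodicMDP S A H} (hP : ∀ h s a, M.P h s a s = 1)
    (D : Fin N → Trajectory S A H) : Convex ℝ (M.tvAIL D) := by
  intro x hx y hy a b ha hb hab
  refine ⟨convex_policies S A H hx.1 hy.1 ha hb hab, fun π' hπ' => ?_⟩
  refine ((convexOn_tvLoss hP D).2 hx.1 hy.1 ha hb hab).trans ?_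
  rw [smul_eq_mul, smul_eq_mul]
  calc _ ≤ a * M.tvLoss D π' + b * M.tvLoss D π' := by
        gcongr
        · exact hx.2 π' hπ'
        · exact hy.2 π' hπ'
    _ = _ := by rw [← add_mul, hab, one_mul]

end EpisodicMDP

/-! ### Moments of sums of independent centered variables -/

section Moments

variable {T : Type*} [Fintype T]

lemma sum_fin_succ_fun {n : ℕ} (F : (Fin (n + 1) → T) → ℝ) :
    ∑ D, F D = ∑ t, ∑ D : Fin n → T, F (Fin.cons t D) := by
  rw [← (Fin.consEquiv fun _ => T).sum_comp, Fintype.sum_prod_type]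
  rfl

variable {w f : T → ℝ}

lemma sum_prod_weight (hw : ∑ t, w t = 1) (N : ℕ) : ∑ D : Fin N → T, ∏ i, w (D i) = 1 := by
  classical
  rw [← Fintype.piFinset_univ, ← Finset.prod_univ_sum]
  simp [hw]

lemma sum_prod_weight_mul_sum (hw : ∑ t, w t = 1) (hf : ∑ t, w t * f t = 0) (N : ℕ) :
    ∑ D : Fin N → T, (∏ i, w (D i)) * ∑ i, f (D i) = 0 := by
  induction N with
  | zero => simp
  | succ n ih =>
    rw [sum_fin_succ_fun]
    simp only [Fin.prod_univ_succ, Fin.sum_univ_succ, Fin.cons_zero, Fin.cons_succ]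
    have h : ∀ t, ∑ D : Fin n → T, (w t * ∏ i, w (D i)) * (f t + ∑ i, f (D i)) =
        w t * f t := by
      intro t
      calc _ = ∑ D : Fin n → T, (w t * f t * (∏ i, w (D i)) +
            w t * ((∏ i, w (D i)) * ∑ i, f (D i))) := by congr! 1; ring
        _ = _ := by rw [Finset.sum_add_distrib, ← Finset.mul_sum, ← Finset.mul_sum, ih,
                  sum_prod_weight hw]; ring
    rw [Finset.sum_congr rfl fun t _ => h t, hf]

lemma sum_prod_weight_mul_sum_sq (hw : ∑ t, w t = 1) (hf : ∑ t, w t * f t = 0) (N : ℕ) :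
    ∑ D : Fin N → T, (∏ i, w (D i)) * (∑ i, f (D i)) ^ 2 = N * ∑ t, w t * f t ^ 2 := by
  induction N with
  | zero => simp
  | succ n ih =>
    rw [sum_fin_succ_fun]
    simp only [Fin.prod_univ_succ, Fin.sum_univ_succ, Fin.cons_zero, Fin.cons_succ]
    have h : ∀ t, ∑ D : Fin n → T, (w t * ∏ i, w (D i)) * (f t + ∑ i, f (D i)) ^ 2 =
        w t * f t ^ 2 + w t * (n * ∑ t, w t * f t ^ 2) := by
      intro t
      calc _ = ∑ D : Fin n → T, (w t * f t ^ 2 * (∏ i, w (D i)) +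
            2 * w t * f t * ((∏ i, w (D i)) * ∑ i, f (D i)) +
            w t * ((∏ i, w (D i)) * (∑ i, f (D i)) ^ 2)) := by congr! 1; ring
        _ = _ := by
          simp only [Finset.sum_add_distrib, ← Finset.mul_sum]
          rw [ih, sum_prod_weight hw, sum_prod_weight_mul_sum hw hf]; ring
    rw [Finset.sum_congr rfl fun t _ => h t, Finset.sum_add_distrib, ← Finset.sum_mul, hw]
    push_cast
    ring

lemma sum_prod_weight_mul_sum_pow_four (hw : ∑ t, w t = 1) (hf : ∑ t, w t * f t = 0) (N : ℕ) :
    ∑ D : Fin N → T, (∏ i, w (D i)) * (∑ i, f (D i)) ^ 4 =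
      N * ∑ t, w t * f t ^ 4 + 3 * N * (N - 1) * (∑ t, w t * f t ^ 2) ^ 2 := by
  induction N with
  | zero => simp
  | succ n ih =>
    rw [sum_fin_succ_fun]
    simp only [Fin.prod_univ_succ, Fin.sum_univ_succ, Fin.cons_zero, Fin.cons_succ]
    set Q := ∑ D : Fin n → T, (∏ i, w (D i)) * (∑ i, f (D i)) ^ 4
    -- The third moment is never evaluated: it only appears multiplied by the mean of `f`, which is
    -- zero.
    set C := ∑ D : Fin n → T, (∏ i, w (D i)) * (∑ i, f (D i)) ^ 3
    set σ := ∑ t, w t * f t ^ 2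
    have h : ∀ t, ∑ D : Fin n → T, (w t * ∏ i, w (D i)) * (f t + ∑ i, f (D i)) ^ 4 =
        w t * f t ^ 4 + 6 * (n * σ) * (w t * f t ^ 2) + 4 * C * (w t * f t) + Q * w t := by
      intro t
      calc _ = ∑ D : Fin n → T, (w t * f t ^ 4 * (∏ i, w (D i)) +
            4 * w t * f t ^ 3 * ((∏ i, w (D i)) * ∑ i, f (D i)) +
            6 * w t * f t ^ 2 * ((∏ i, w (D i)) * (∑ i, f (D i)) ^ 2) +
            4 * w t * f t * ((∏ i, w (D i)) * (∑ i, f (D i)) ^ 3) +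
            w t * ((∏ i, w (D i)) * (∑ i, f (D i)) ^ 4)) := by congr! 1; ring
        _ = _ := by
          simp only [Finset.sum_add_distrib, ← Finset.mul_sum]
          rw [sum_prod_weight hw, sum_prod_weight_mul_sum hw hf,
            sum_prod_weight_mul_sum_sq hw hf]; ring
    rw [Finset.sum_congr rfl fun t _ => h t]
    simp only [Finset.sum_add_distrib, ← Finset.mul_sum]
    rw [hw, hf, ih]
    push_cast
    ring

/-- With `y = κ|x|` this is `|x|` times the inequality `1 - 2y + 2y³ ≥ 0` for `y ≥ 0`. The free
scale `κ` is later matched to the inverse standard deviation. -/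
lemma two_mul_sq_sub_pow_four_le_abs (x : ℝ) {κ : ℝ} (hκ : 0 ≤ κ) :
    2 * (κ * x ^ 2 - κ ^ 3 * x ^ 4) ≤ |x| := by
  rw [← sq_abs x, show x ^ 4 = |x| ^ 4 by rw [← abs_pow, abs_of_nonneg (by positivity)]]
  set a := |x|
  have ha : 0 ≤ a := abs_nonneg x
  have hy : 0 ≤ κ * a := by positivity
  have h : 0 ≤ 1 - 2 * (κ * a) + 2 * (κ * a) ^ 3 := by
    nlinarith [mul_nonneg hy (sq_nonneg (2 * (κ * a) - 1)), sq_nonneg (3 * (κ * a) - 2)]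
  nlinarith [mul_nonneg ha h]

/-- A lower bound for the mean absolute value of a sum of independent centered variables, from
its second and fourth moments. -/
lemma le_sum_prod_weight_mul_abs_sum (hw0 : ∀ t, 0 ≤ w t) (hw : ∑ t, w t = 1)
    (hf : ∑ t, w t * f t = 0) (hf1 : ∀ t, |f t| ≤ 1) (N : ℕ) {κ : ℝ} (hκ : 0 ≤ κ)
    (hκN : κ ^ 2 * (3 * (N * ∑ t, w t * f t ^ 2) + 1) ≤ 1 / 2) :
    κ * (N * ∑ t, w t * f t ^ 2) ≤ ∑ D : Fin N → T, (∏ i, w (D i)) * |∑ i, f (D i)| := by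
  have h2 := sum_prod_weight_mul_sum_sq hw hf N
  have h4 := sum_prod_weight_mul_sum_pow_four hw hf N
  have hle : ∑ t, w t * f t ^ 4 ≤ ∑ t, w t * f t ^ 2 := by
    refine Finset.sum_le_sum fun t _ => mul_le_mul_of_nonneg_left ?_ (hw0 t)
    have : f t ^ 2 ≤ 1 := (sq_le_one_iff_abs_le_one _).2 (hf1 t)
    nlinarith [sq_nonneg (f t)]
  have hmain : 2 * (κ * ∑ D : Fin N → T, (∏ i, w (D i)) * (∑ i, f (D i)) ^ 2 -
      κ ^ 3 * ∑ D : Fin N → T, (∏ i, w (D i)) * (∑ i, f (D i)) ^ 4) ≤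
      ∑ D : Fin N → T, (∏ i, w (D i)) * |∑ i, f (D i)| := by
    rw [Finset.mul_sum, Finset.mul_sum, ← Finset.sum_sub_distrib, Finset.mul_sum]
    refine Finset.sum_le_sum fun D _ => ?_
    have h := mul_le_mul_of_nonneg_left (two_mul_sq_sub_pow_four_le_abs (∑ i, f (D i)) hκ)
      (Finset.prod_nonneg fun i (_ : i ∈ Finset.univ) => hw0 (D i))
    linarith
  rw [h2, h4] at hmain
  have hσ : 0 ≤ ∑ t, w t * f t ^ 2 :=
    Finset.sum_nonneg fun t _ => mul_nonneg (hw0 t) (sq_nonneg _)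
  set σ := ∑ t, w t * f t ^ 2
  -- With `V = Nσ`, the fourth moment is at most `V(3V + 1)`, so the hypothesis on `κ` makes the
  -- subtracted term at most half of `κV`.
  have hq : N * ∑ t, w t * f t ^ 4 + 3 * N * (N - 1) * σ ^ 2 ≤ N * σ * (3 * (N * σ) + 1) := by
    have h1 : N * ∑ t, w t * f t ^ 4 ≤ N * σ := mul_le_mul_of_nonneg_left hle (Nat.cast_nonneg N)
    have h3 : 0 ≤ (N : ℝ) * σ ^ 2 := by positivity
    nlinarith
  have hN : 0 ≤ κ * (N * σ) := by positivity
  have h5 := mul_le_mul_of_nonneg_left hq (pow_nonneg hκ 3)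
  have h6 := mul_le_mul_of_nonneg_left hκN hN
  nlinarith

end Moments

/-! ### Threshold policies and their symmetries -/

variable {S A : Type*} {H : ℕ}

/-- The policy that always plays the action `a₁`. -/
noncomputable def constPolicy [DecidableEq A] (S : Type*) (H : ℕ) (a₁ : A) : PolicySpace S A H :=
  WithLp.toLp 2 fun x => if x.2.2 = a₁ then 1 else 0

@[simp]
lemma constPolicy_apply [DecidableEq A] (a₁ : A) (h : Fin H) (s : S) (a : A) :
    constPolicy S H a₁ (h, s, a) = if a = a₁ then 1 else 0 := rfl

variable [Fintype A]

lemma constPolicy_mem [DecidableEq A] (a₁ : A) : constPolicy S H a₁ ∈ policies S A H := by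
  refine fun h s => ⟨fun a => ?_, by simp⟩
  simp only [constPolicy_apply]
  split_ifs <;> norm_num

lemma policies_apply_le_one {π : PolicySpace S A H} (hπ : π ∈ policies S A H) (h : Fin H) (s : S)
    (a : A) : π (h, s, a) ≤ 1 :=
  (mem_Icc_of_mem_stdSimplex (hπ h s) a).2

lemma policies_add_le_one {π : PolicySpace S A H} (hπ : π ∈ policies S A H) (h : Fin H) (s : S)
    {a b : A} (hab : a ≠ b) : π (h, s, a) + π (h, s, b) ≤ 1 := by
  classical
  rw [← (hπ h s).2, ← Finset.sum_pair (f := fun a => π (h, s, a)) hab]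
  exact Finset.sum_le_sum_of_subset_of_nonneg (Finset.subset_univ _) fun a _ _ => (hπ h s).1 a

/-- The policies that play `a₁` in the state `s` with probability at least `t s`. -/
def thresholdPolicies (H : ℕ) (a₁ : A) (t : S → ℝ) : Set (PolicySpace S A H) :=
  {π | π ∈ policies S A H ∧ ∀ h s, t s ≤ π (h, s, a₁)}

lemma isCompact_thresholdPolicies [Fintype S] (a₁ : A) (t : S → ℝ) :
    IsCompact (thresholdPolicies H a₁ t) := by
  refine (isCompact_policies S A H).inter_right (t := {π | ∀ h s, t s ≤ π (h, s, a₁)}) ?_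
  simp only [Set.ofPred_forall]
  exact isClosed_iInter fun h => isClosed_iInter fun s =>
    isClosed_le continuous_const (by fun_prop)

lemma convex_thresholdPolicies (a₁ : A) (t : S → ℝ) :
    Convex ℝ (thresholdPolicies H a₁ t) := by
  intro x hx y hy a b ha hb hab
  refine ⟨convex_policies S A H hx.1 hy.1 ha hb hab, fun h s => ?_⟩
  exact convex_Ici (𝕜 := ℝ) (t s) (hx.2 h s) (hy.2 h s) ha hb hab

lemma nonempty_thresholdPolicies [DecidableEq A] (a₁ : A) {t : S → ℝ} (ht : ∀ s, t s ≤ 1) :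
    (thresholdPolicies H a₁ t).Nonempty :=
  ⟨constPolicy S H a₁, constPolicy_mem a₁, fun h s => by simpa using ht s⟩

/-- The isometry of the policy space that exchanges the coordinates `i` and `j` and then moves an
amount `t` from the coordinate `j` to the coordinate `i`. -/
noncomputable def swapShift {ι : Type*} [Fintype ι] [DecidableEq ι] (i j : ι) (t : ℝ) :
    EuclideanSpace ℝ ι ≃ᵢ EuclideanSpace ℝ ι :=
  (LinearIsometryEquiv.piLpCongrLeft 2 ℝ ℝ (Equiv.swap i j)).toIsometryEquiv.trans
    (IsometryEquiv.addRight (WithLp.toLp 2 fun k => if k = i then t else if k = j then -t else 0))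

lemma swapShift_apply {ι : Type*} [Fintype ι] [DecidableEq ι] (i j : ι) (t : ℝ)
    (x : EuclideanSpace ℝ ι) (k : ι) :
    swapShift i j t x k =
      x (Equiv.swap i j k) + if k = i then t else if k = j then -t else 0 := by
  simp [swapShift, LinearIsometryEquiv.piLpCongrLeft_apply, Equiv.piCongrLeft']

lemma swapShift_swapShift {ι : Type*} [Fintype ι] [DecidableEq ι] {i j : ι} (hij : i ≠ j) (t : ℝ)
    (x : EuclideanSpace ℝ ι) : swapShift i j t (swapShift i j t x) = x := by
  ext k
  rw [swapShift_apply, swapShift_apply, Equiv.swap_apply_self]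
  by_cases hi : k = i
  · simp [hi, hij.symm]
  · by_cases hj : k = j
    · simp [hj, hij.symm]
    · simp [hi, hj, Equiv.swap_apply_of_ne_of_ne]

variable [Fintype S] [DecidableEq S] [DecidableEq A]

/-- The new mass of `a₁` is `π(a₂) + t ≥ t`, the new mass of `a₂` is `π(a₁) - t ≥ 0` by the
threshold constraint, and the total is unchanged. -/
lemma swapShift_mem_thresholdPolicies {a₁ a₂ : A} (ha : a₁ ≠ a₂) {t : S → ℝ} (ht : ∀ s, 0 ≤ t s)
    (h : Fin H) (s : S) {π : PolicySpace S A H} (hπ : π ∈ thresholdPolicies H a₁ t) :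
    swapShift (h, s, a₁) (h, s, a₂) (t s) π ∈ thresholdPolicies H a₁ t := by
  set π' := swapShift (h, s, a₁) (h, s, a₂) (t s) π with hπ'
  have hout : ∀ h' s', ¬(h' = h ∧ s' = s) → ∀ a, π' (h', s', a) = π (h', s', a) := by
    intro h' s' hne a
    rw [hπ', swapShift_apply, Equiv.swap_apply_of_ne_of_ne]
    · simp only [Prod.mk.injEq]
      rw [if_neg (by tauto), if_neg (by tauto), add_zero]
    · simp only [ne_eq, Prod.mk.injEq]; tauto
    · simp only [ne_eq, Prod.mk.injEq]; tauto
  have hin : ∀ a, π' (h, s, a) =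
      π (h, s, Equiv.swap a₁ a₂ a) + if a = a₁ then t s else if a = a₂ then -t s else 0 := by
    intro a
    rw [hπ', swapShift_apply]
    simp only [Prod.mk.injEq, true_and]
    congr 2
    simp only [Equiv.swap_apply_def, Prod.mk.injEq, true_and]
    split_ifs <;> rfl
  refine ⟨fun h' s' => ?_, fun h' s' => ?_⟩
  · by_cases hc : h' = h ∧ s' = s
    · obtain ⟨rfl, rfl⟩ := hc
      refine ⟨fun a => ?_, ?_⟩
      · change 0 ≤ π' (h', s', a)
        rw [hin]
        split_ifs with h1 h2
        · exact add_nonneg ((hπ.1 _ _).1 _) (ht _)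
        · rw [h2, Equiv.swap_apply_right]
          linarith [hπ.2 h' s']
        · simpa using (hπ.1 _ _).1 _
      · simp only [hin]
        rw [Finset.sum_add_distrib, Equiv.sum_comp (Equiv.swap a₁ a₂) fun a => π (h', s', a),
          (hπ.1 h' s').2, Finset.sum_ite, Finset.sum_ite]
        simp [Finset.filter_ne', Finset.filter_eq', ha.symm]
    · simpa only [hout h' s' hc] using hπ.1 h' s'
  · by_cases hc : h' = h ∧ s' = s
    · obtain ⟨rfl, rfl⟩ := hc
      rw [hin]
      simpa using (hπ.1 _ _).1 _
    · rw [hout h' s' hc]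
      exact hπ.2 h' s'

lemma preimage_swapShift_thresholdPolicies {a₁ a₂ : A} (ha : a₁ ≠ a₂) {t : S → ℝ}
    (ht : ∀ s, 0 ≤ t s) (h : Fin H) (s : S) :
    swapShift (h, s, a₁) (h, s, a₂) (t s) ⁻¹' thresholdPolicies H a₁ t =
      thresholdPolicies H a₁ t := by
  refine Set.Subset.antisymm (fun π hπ => ?_)
    fun π hπ => swapShift_mem_thresholdPolicies ha ht h s hπ
  have := swapShift_mem_thresholdPolicies ha ht h s hπ
  rwa [swapShift_swapShift (by simpa using ha)] at this

/-- Under the uniform distribution on the policies that play `a₁` with probability at least `t s`,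
the mean probability of `a₁` is at most the midpoint of `t s` and `1`. -/
lemma integral_uniformMeasure_thresholdPolicies_le {a₁ a₂ : A} (ha : a₁ ≠ a₂) {t : S → ℝ}
    (ht : ∀ s, 0 ≤ t s) (ht1 : ∀ s, t s ≤ 1) (h : Fin H) (s : S) :
    ∫ π, π (h, s, a₁) ∂uniformMeasure (thresholdPolicies H a₁ t) ≤ (1 + t s) / 2 := by
  set K := thresholdPolicies H a₁ t
  have hK : IsCompact K := isCompact_thresholdPolicies a₁ t
  have hc : Convex ℝ K := convex_thresholdPolicies a₁ t
  have hne : K.Nonempty := nonempty_thresholdPolicies a₁ ht1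
  have := isProbabilityMeasure_uniformMeasure hK hc hne
  have hint : ∀ a, Integrable (fun π : PolicySpace S A H => π (h, s, a)) (uniformMeasure K) :=
    fun a => integrable_uniformMeasure hK hc hne (by fun_prop)
  let e := swapShift (h, s, a₁) (h, s, a₂) (t s)
  have hpres : MeasurePreserving e (uniformMeasure K) (uniformMeasure K) :=
    measurePreserving_uniformMeasure hK.measurableSet e
      (preimage_swapShift_thresholdPolicies ha ht h s)
  -- Invariance makes the mean of `a₁` equal to that of `a₂` plus `t`, while the two means add up to
  -- at most `1`.
  have h1 : ∫ π, π (h, s, a₁) ∂uniformMeasure K =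
      ∫ π, (π (h, s, a₂) + t s) ∂uniformMeasure K := by
    rw [← hpres.integral_comp e.toHomeomorph.measurableEmbedding]
    simp [e, swapShift_apply]
  rw [integral_add (hint a₂) (integrable_const _)] at h1
  have h2 : ∫ π, (π (h, s, a₁) + π (h, s, a₂)) ∂uniformMeasure K ≤
      ∫ _, (1 : ℝ) ∂uniformMeasure K := by
    refine integral_mono_ae ((hint a₁).add (hint a₂)) (integrable_const _) ?_
    filter_upwards [ProbabilityTheory.ae_cond_mem hK.measurableSet] with π hπ
    exact policies_add_le_one hπ.1 h s ha
  rw [integral_add (hint a₁) (hint a₂)] at h2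
  simp at h1 h2
  linarith

/-! ### The minimizers of TV-AIL and their mean value -/

lemma abs_sub_add_one_sub_le {ρ q x : ℝ} (hρ : 0 < ρ) (hx : x ≤ 1) :
    |ρ * 1 - q| + ρ * (1 - 1) ≤ |ρ * x - q| + ρ * (1 - x) := by
  have := abs_add_le (ρ * x - q) (ρ * (1 - x))
  rw [abs_of_nonneg (mul_nonneg hρ.le (sub_nonneg.2 hx))] at this
  refine le_trans (le_of_eq ?_) this
  ring_nf

/-- On `x ≤ 1` the loss falls with slope `-2ρ` until `x = q/ρ` and is constant afterwards. -/
lemma abs_sub_add_one_sub_eq_iff {ρ q x : ℝ} (hρ : 0 < ρ) (hx : x ≤ 1) :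
    |ρ * 1 - q| + ρ * (1 - 1) = |ρ * x - q| + ρ * (1 - x) ↔ min (q / ρ) 1 ≤ x := by
  have h1 : ρ * x ≤ ρ := by nlinarith
  rw [min_le_iff, div_le_iff₀ hρ]
  constructor
  · intro h
    by_contra! hlt
    rw [abs_of_neg (show ρ * x - q < 0 by linarith)] at h
    have h2 : ρ * x < ρ := by nlinarith
    rcases le_total (ρ * 1 - q) 0 with h3 | h3
    · rw [abs_of_nonpos h3] at h
      linarith
    · rw [abs_of_nonneg h3] at h
      linarith
  · rintro (h | h)
    · rw [abs_of_nonneg (by linarith), abs_of_nonneg (by linarith)]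
      ring
    · rw [le_antisymm hx h]

namespace EpisodicMDP

variable {N : ℕ} {M : EpisodicMDP S A H} {D : Fin N → Trajectory S A H} {a₁ : A} {q : S → ℝ}

/-- Actions other than `a₁` are absent from the data, so they contribute all of their mass, `ρ(s)(1
- π_h(a₁|s))`. -/
lemma tvLoss_eq (hP : ∀ h s a, M.P h s a s = 1)
    (hD : ∀ h s a, empirical D h s a = if a = a₁ then q s else 0)
    {π : PolicySpace S A H} (hπ : π ∈ policies S A H) :
    M.tvLoss D π = ∑ x : Fin H × S, (|M.ρ x.2 * π (x.1, x.2, a₁) - q x.2| +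
      M.ρ x.2 * (1 - π (x.1, x.2, a₁))) := by
  rw [tvLoss, Fintype.sum_prod_type]
  refine Finset.sum_congr rfl fun h _ => Finset.sum_congr rfl fun s _ => ?_
  simp only [occupancy_eq hP hπ, hD]
  rw [← Finset.add_sum_erase _ _ (Finset.mem_univ a₁), if_pos rfl, ← (hπ h s).2,
    ← Finset.add_sum_erase _ (fun a => π (h, s, a)) (Finset.mem_univ a₁), add_sub_cancel_left,
    Finset.mul_sum]
  congr 1
  refine Finset.sum_congr rfl fun a ha => ?_
  rw [if_neg (Finset.ne_of_mem_erase ha), sub_zero,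
    abs_of_nonneg (mul_nonneg (M.ρ_mem.1 s) ((hπ h s).1 a))]

/-- On a dataset in which only `a₁` is played, the solutions of TV-AIL are the policies that play
`a₁` with at least a certain probability in each state. -/
lemma tvAIL_eq (hP : ∀ h s a, M.P h s a s = 1) (hρ : ∀ s, 0 < M.ρ s)
    (hD : ∀ h s a, empirical D h s a = if a = a₁ then q s else 0) :
    M.tvAIL D = thresholdPolicies H a₁ fun s => min (q s / M.ρ s) 1 := by
  have hE : M.tvLoss D (constPolicy S H a₁) =
      ∑ x : Fin H × S, (|M.ρ x.2 * 1 - q x.2| + M.ρ x.2 * (1 - 1)) := by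
    simp [tvLoss_eq hP hD (constPolicy_mem a₁)]
  have hle : ∀ π ∈ policies S A H, M.tvLoss D (constPolicy S H a₁) ≤ M.tvLoss D π := by
    intro π hπ
    rw [hE, tvLoss_eq hP hD hπ]
    exact Finset.sum_le_sum fun x _ =>
      abs_sub_add_one_sub_le (hρ _) (policies_apply_le_one hπ _ _ _)
  ext π
  refine and_congr_right fun hπ => ?_
  have h1 : (∀ π' ∈ policies S A H, M.tvLoss D π ≤ M.tvLoss D π') ↔
      M.tvLoss D (constPolicy S H a₁) = M.tvLoss D π :=
    ⟨fun h => le_antisymm (hle π hπ) (h _ (constPolicy_mem a₁)), fun h => h ▸ hle⟩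
  -- The constant policy minimizes every summand at once, so optimality of the sum is equality in
  -- each term.
  rw [h1, hE, tvLoss_eq hP hD hπ, Finset.sum_eq_sum_iff_of_le fun x _ =>
      abs_sub_add_one_sub_le (hρ _) (policies_apply_le_one hπ _ _ _)]
  simp only [Finset.mem_univ, forall_const, Prod.forall]
  exact forall₂_congr fun h s =>
    abs_sub_add_one_sub_eq_iff (hρ _) (policies_apply_le_one hπ _ _ _)

lemma value_eq_of_reward (hP : ∀ h s a, M.P h s a s = 1)
    (hr : ∀ h s a, M.r h s a = if a = a₁ then 1 else 0)
    {π : PolicySpace S A H} (hπ : π ∈ policies S A H) :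
    M.value π = ∑ h, ∑ s, M.ρ s * π (h, s, a₁) := by
  simp [value_eq hP hπ, hr]

lemma isProbabilityMeasure_tvAILLaw [Nonempty A] (hP : ∀ h s a, M.P h s a s = 1)
    (D : Fin N → Trajectory S A H) : IsProbabilityMeasure (M.tvAILLaw D) :=
  isProbabilityMeasure_uniformMeasure (M.isCompact_tvAIL D) (convex_tvAIL hP D)
    (M.nonempty_tvAIL D ⟨_, constPolicy_mem (Classical.arbitrary A)⟩)

lemma integrable_value_tvAILLaw [Nonempty A] (hP : ∀ h s a, M.P h s a s = 1)
    (D : Fin N → Trajectory S A H) : Integrable (fun π => M.value π) (M.tvAILLaw D) :=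
  integrable_uniformMeasure (M.isCompact_tvAIL D) (convex_tvAIL hP D)
    (M.nonempty_tvAIL D ⟨_, constPolicy_mem (Classical.arbitrary A)⟩) M.continuous_value

/-- The midpoint bound costs `ρ(1 - t)/2 = (ρ - q)⁺/2`. It is written as `(|q - ρ| - (q - ρ))/4` so
that the signed part averages out over the data. -/
lemma integral_value_tvAILLaw_le {a₂ : A} (ha : a₁ ≠ a₂) (hP : ∀ h s a, M.P h s a s = 1)
    (hρ : ∀ s, 0 < M.ρ s) (hr : ∀ h s a, M.r h s a = if a = a₁ then 1 else 0)
    (hq : ∀ s, 0 ≤ q s) (hD : ∀ h s a, empirical D h s a = if a = a₁ then q s else 0) :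
    ∫ π, M.value π ∂M.tvAILLaw D ≤ H * ∑ s, (M.ρ s - (|q s - M.ρ s| - (q s - M.ρ s)) / 4) := by
  have : Nonempty A := ⟨a₁⟩
  have hprob := isProbabilityMeasure_tvAILLaw hP D
  have hint : ∀ h s, Integrable (fun π : PolicySpace S A H => M.ρ s * π (h, s, a₁))
      (M.tvAILLaw D) := fun h s =>
    integrable_uniformMeasure (M.isCompact_tvAIL D) (convex_tvAIL hP D)
      (M.nonempty_tvAIL D ⟨_, constPolicy_mem a₁⟩) (by fun_prop)
  have h1 : ∫ π, M.value π ∂M.tvAILLaw D =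
      ∫ π, ∑ h, ∑ s, M.ρ s * π (h, s, a₁) ∂M.tvAILLaw D := by
    refine integral_congr_ae ?_
    filter_upwards [ProbabilityTheory.ae_cond_mem (M.isCompact_tvAIL D).measurableSet] with π hπ
    exact value_eq_of_reward hP hr hπ.1
  rw [h1, integral_finsetSum _ fun h _ => integrable_finsetSum _ fun s _ => hint h s]
  have h2 : ∀ h : Fin H, ∫ π, ∑ s, M.ρ s * π (h, s, a₁) ∂M.tvAILLaw D ≤
      ∑ s, (M.ρ s - (|q s - M.ρ s| - (q s - M.ρ s)) / 4) := by
    intro h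
    rw [integral_finsetSum _ fun s _ => hint h s]
    refine Finset.sum_le_sum fun s _ => ?_
    rw [integral_const_mul, tvAILLaw, tvAIL_eq hP hρ hD]
    have h3 := mul_le_mul_of_nonneg_left (integral_uniformMeasure_thresholdPolicies_le
      (t := fun s => min (q s / M.ρ s) 1) ha
      (fun s => le_min (div_nonneg (hq s) (hρ s).le) zero_le_one) (fun s => min_le_right _ _) h s)
      (hρ s).le
    refine h3.trans (le_of_eq ?_)
    have hρs := hρ s
    rcases le_total (q s) (M.ρ s) with hle | hle
    · rw [min_eq_left ((div_le_one hρs).2 hle), abs_of_nonpos (by linarith)]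
      field_simp
      ring
    · rw [min_eq_right ((one_le_div hρs).2 hle), abs_of_nonneg (by linarith)]
      ring
  refine (Finset.sum_le_sum fun h _ => h2 h).trans (le_of_eq ?_)
  rw [Finset.sum_const, Finset.card_univ, Fintype.card_fin, nsmul_eq_mul]

end EpisodicMDP

end ImitationLearning

/-! ### The hard instance and the average over datasets -/

namespace ImitationLearning.EpisodicMDP

section Absorbing

variable {S A : Type*} [Fintype S] [DecidableEq S] [DecidableEq A]

/-- The MDP with absorbing states, uniform initial distribution, and reward `1` for the action
`a₁` only. -/
noncomputable def absorbing [Nonempty S] (H : ℕ) (a₁ : A) : EpisodicMDP S A H where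
  ρ _ := 1 / Fintype.card S
  ρ_mem := ⟨fun _ => by positivity, by simp⟩
  P _ s _ := Pi.single s 1
  P_mem _ s _ := single_mem_stdSimplex ℝ s
  r _ _ a := if a = a₁ then 1 else 0
  r_mem _ _ a := by split_ifs <;> simp

end Absorbing

variable {S A : Type*} [Fintype S] [DecidableEq S] {H N : ℕ} {M : EpisodicMDP S A H} {a₁ : A}

/-- A dataset that has positive probability under the policy that always plays `a₁` determines
its empirical distributions by the initial states. -/
lemma empirical_eq_of_prod_ne_zero [DecidableEq A]
    (hP : ∀ h s a, M.P h s a s = 1) (h₀ : Fin H)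
    {D : Fin N → Trajectory S A H} (hD : ∏ i, M.trajProb (constPolicy S H a₁) (D i) ≠ 0)
    (h : Fin H) (s : S) (a : A) :
    empirical D h s a =
      if a = a₁ then (∑ i, if (D i h₀).1 = s then (1 : ℝ) else 0) / N else 0 := by
  have hi : ∀ i, D i h = ((D i h₀).1, a₁) := by
    intro i
    have h1 := Finset.prod_ne_zero_iff.1 hD i (Finset.mem_univ i)
    refine Prod.ext (fst_eq_of_trajProb_ne_zero hP h1 h h₀) ?_
    have h2 := right_ne_zero_of_mul (Finset.prod_ne_zero_iff.1 h1 h (Finset.mem_univ h))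
    by_contra hne
    exact h2 (if_neg hne)
  simp only [empirical, hi, Prod.mk.injEq]
  split_ifs with ha
  · simp [ha]
  · simp [Ne.symm ha]

variable [Fintype A]

/-- At every step the state `s` is visited with probability `ρ(s)`. -/
lemma sum_trajProb_mul_comp_indicator {π : PolicySpace S A H} (hP : ∀ h s a, M.P h s a s = 1)
    (hπ : π ∈ policies S A H) (h : Fin H) (s : S) (φ : ℝ → ℝ) :
    ∑ tr, M.trajProb π tr * φ (if (tr h).1 = s then 1 else 0) =
      M.ρ s * φ 1 + (1 - M.ρ s) * φ 0 := by
  have hsplit : ∀ s', φ (if s' = s then 1 else 0) =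
      φ 0 + if s' = s then φ 1 - φ 0 else 0 := by
    intro s'
    split_ifs <;> ring
  rw [sum_trajProb_mul hP hπ h fun x => φ (if x.1 = s then 1 else 0)]
  have hin : ∀ s', ∑ a, π (h, s', a) * φ (if s' = s then 1 else 0) =
      φ (if s' = s then 1 else 0) := fun s' => by rw [← Finset.sum_mul, (hπ h s').2, one_mul]
  simp only [hin]
  simp only [hsplit, mul_add, Finset.sum_add_distrib, ← Finset.sum_mul,
    M.ρ_mem.2, mul_ite, mul_zero, Finset.sum_ite_eq', Finset.mem_univ, if_true]
  ring

/-- The expected suboptimality of TV-AIL is governed by the `ℓ¹` error of the empirical initial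
state distribution. -/
lemma expectedAILValue_le [DecidableEq A] {a₂ : A} (ha : a₁ ≠ a₂) (hP : ∀ h s a, M.P h s a s = 1)
    (hρ : ∀ s, 0 < M.ρ s) (hr : ∀ h s a, M.r h s a = if a = a₁ then 1 else 0) (hN : 1 ≤ N)
    (h₀ : Fin H) :
    M.expectedAILValue (constPolicy S H a₁) N ≤ H - H / (4 * N) *
      ∑ s, ∑ D : Fin N → Trajectory S A H, (∏ i, M.trajProb (constPolicy S H a₁) (D i)) *
        |∑ i, ((if (D i h₀).1 = s then (1 : ℝ) else 0) - M.ρ s)| := by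
  set w := M.trajProb (constPolicy S H a₁)
  have hE : constPolicy S H a₁ ∈ policies S A H := constPolicy_mem a₁
  have hw0 : ∀ tr, 0 ≤ w tr := M.trajProb_nonneg hE
  have hw : ∑ tr, w tr = 1 := sum_trajProb hP h₀.pos hE
  let f : S → Trajectory S A H → ℝ := fun s tr => (if (tr h₀).1 = s then 1 else 0) - M.ρ s
  have hf : ∀ s, ∑ tr, w tr * f s tr = 0 := by
    intro s
    exact (sum_trajProb_mul_comp_indicator hP hE h₀ s fun x => x - M.ρ s).trans (by ring)
  have hN0 : (N : ℝ) ≠ 0 := by positivity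
  have hterm : ∀ D : Fin N → Trajectory S A H,
      (∏ i, w (D i)) * ∫ π, M.value π ∂M.tvAILLaw D ≤
        (∏ i, w (D i)) * H - H / (4 * N) * ∑ s, ((∏ i, w (D i)) * |∑ i, f s (D i)| -
          (∏ i, w (D i)) * ∑ i, f s (D i)) := by
    intro D
    -- Datasets of probability zero may contain other actions, and the description of the minimizers
    -- need not apply to them.
    by_cases hD : ∏ i, w (D i) = 0
    · simp [hD]
    have h1 := integral_value_tvAILLaw_le ha hP hρ hr
      (q := fun s => (∑ i, if (D i h₀).1 = s then (1 : ℝ) else 0) / N)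
      (fun s => div_nonneg (Finset.sum_nonneg fun i _ => by positivity) (Nat.cast_nonneg N))
      (empirical_eq_of_prod_ne_zero hP h₀ hD)
    refine (mul_le_mul_of_nonneg_left h1 (Finset.prod_nonneg fun i _ => hw0 (D i))).trans
      (le_of_eq ?_)
    have hq : ∀ s, (∑ i, if (D i h₀).1 = s then (1 : ℝ) else 0) / N - M.ρ s =
        (∑ i, f s (D i)) / N := by
      intro s
      simp only [f, Finset.sum_sub_distrib, Finset.sum_const, Finset.card_univ, Fintype.card_fin,
        nsmul_eq_mul]
      field_simp
    simp only [hq, abs_div, Nat.abs_cast]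
    rw [Finset.sum_sub_distrib, M.ρ_mem.2, mul_sub, mul_sub, Finset.mul_sum, Finset.mul_sum,
      Finset.mul_sum, mul_one]
    congr 1
    refine Finset.sum_congr rfl fun s _ => ?_
    field_simp
  refine (Finset.sum_le_sum fun D _ => hterm D).trans (le_of_eq ?_)
  rw [Finset.sum_sub_distrib, ← Finset.sum_mul, sum_prod_weight hw, one_mul, ← Finset.mul_sum,
    Finset.sum_comm]
  congr 2
  refine Finset.sum_congr rfl fun s _ => ?_
  rw [Finset.sum_sub_distrib, sum_prod_weight_mul_sum hw (hf s), sub_zero]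

/-- The mean absolute error of the empirical count of an initial state with probability at
most `1 / 2`. -/
lemma le_sum_prod_trajProb_mul_abs {πE : PolicySpace S A H} (hP : ∀ h s a, M.P h s a s = 1)
    (hE : πE ∈ policies S A H) (h₀ : Fin H) (s : S) (hs : M.ρ s ≤ 1 / 2) (N : ℕ) {μ : ℝ}
    (hμ0 : 0 ≤ μ) (hμ1 : μ ≤ 1) (hμ : μ ^ 2 * (N * M.ρ s) ≤ 1) :
    μ * (N * M.ρ s) / 6 ≤ ∑ D : Fin N → Trajectory S A H, (∏ i, M.trajProb πE (D i)) *
        |∑ i, ((if (D i h₀).1 = s then (1 : ℝ) else 0) - M.ρ s)| := by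
  have hρ0 := M.ρ_mem.1 s
  have hmom := sum_trajProb_mul_comp_indicator hP hE h₀ s
  have hvar : ∑ tr, M.trajProb πE tr *
      ((if (tr h₀).1 = s then (1 : ℝ) else 0) - M.ρ s) ^ 2 = M.ρ s * (1 - M.ρ s) := by
    rw [hmom fun x => (x - M.ρ s) ^ 2]
    ring
  -- For `κ = μ/3`, the bound `μ²Nρ ≤ 1` gives `κ²(3Nρ(1 - ρ) + 1) ≤ 4/9 < 1/2`. Then `1 - ρ ≥ 1/2`
  -- turns `κNρ(1 - ρ)` into at least `μNρ/6`.
  have h := le_sum_prod_weight_mul_abs_sum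
    (f := fun tr : Trajectory S A H => (if (tr h₀).1 = s then (1 : ℝ) else 0) - M.ρ s)
    (M.trajProb_nonneg hE) (sum_trajProb hP h₀.pos hE)
    ((hmom fun x => x - M.ρ s).trans (by ring)) (fun tr => by
      rw [abs_le]; split_ifs <;> constructor <;> linarith) N (κ := μ / 3) (by positivity) ?_
  · refine le_trans ?_ h
    rw [hvar]
    have : 0 ≤ μ * (N * M.ρ s) := by positivity
    nlinarith
  · rw [hvar]
    have h1 : 0 ≤ μ ^ 2 * (N * M.ρ s) * M.ρ s := by positivity
    have h2 : μ ^ 2 ≤ 1 := by nlinarith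
    nlinarith

end ImitationLearning.EpisodicMDP

/-! ### The main theorem -/

open ImitationLearning ImitationLearning.EpisodicMDP

theorem mainTheorem5 :
    ∃ c : ℝ, 0 < c ∧
      ∀ (S A : Type*) [Fintype S] [Fintype A] [DecidableEq S] [DecidableEq A] (H : ℕ),
        2 ≤ Fintype.card S → 2 ≤ Fintype.card A → 1 ≤ H →
        ∃ (M : ImitationLearning.EpisodicMDP S A H) (πE : ImitationLearning.PolicySpace S A H),
          πE ∈ ImitationLearning.policies S A H ∧
          ImitationLearning.IsolatedAbsorbing M πE ∧
          ∀ N : ℕ, 1 ≤ N →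
            (∀ D : Fin N → ImitationLearning.Trajectory S A H,
              IsProbabilityMeasure (M.tvAILLaw D) ∧
              Integrable (fun π => M.value π) (M.tvAILLaw D)) ∧
            c * min (H : ℝ) (H * Real.sqrt ((Fintype.card S : ℝ) / N)) ≤
              M.value πE - M.expectedAILValue πE N := by
  -- The constant is `1/4` from the value gap times `1/6` from the mean absolute deviation.
  refine ⟨1 / 24, by norm_num, fun S A _ _ _ _ H hS hA hH => ?_⟩
  have : Nonempty S := Fintype.card_pos_iff.1 (by omega)
  obtain ⟨a₁, a₂, ha⟩ := Fintype.exists_pair_of_one_lt_card (α := A) (by omega)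
  have : Nonempty A := ⟨a₁⟩
  let M : EpisodicMDP S A H := absorbing H a₁
  have hP : ∀ h s a, M.P h s a s = 1 := fun h s a => Pi.single_eq_same _ _
  have hr : ∀ h s a, M.r h s a = if a = a₁ then 1 else 0 := fun _ _ _ => rfl
  have hn : (2 : ℝ) ≤ Fintype.card S := by exact_mod_cast hS
  have hρ : ∀ s, M.ρ s = 1 / Fintype.card S := fun _ => rfl
  have hE := constPolicy_mem (S := S) (H := H) a₁
  refine ⟨M, constPolicy S H a₁, hE, ⟨hP, a₁, fun h s => ⟨by simp, by simp [hr],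
    fun a ha => by simp [hr, ha]⟩⟩, fun N hN => ⟨fun D =>
      ⟨isProbabilityMeasure_tvAILLaw hP D, integrable_value_tvAILLaw hP D⟩, ?_⟩⟩
  have hNpos : (0 : ℝ) < N := by exact_mod_cast hN
  have hV : M.value (constPolicy S H a₁) = H := by
    simp [value_eq_of_reward hP hr hE, M.ρ_mem.2]
  have h1 := expectedAILValue_le ha hP (fun s => by rw [hρ]; positivity) hr hN ⟨0, hH⟩
  -- With `ρ = 1/|S|`, this is the largest `μ ≤ 1` with `μ²Nρ ≤ 1`, and `Hμ` is the target minimum.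
  set μ := min 1 (Real.sqrt (Fintype.card S / N)) with hμ
  have hμ0 : 0 ≤ μ := le_min zero_le_one (Real.sqrt_nonneg _)
  have hμsq : μ ^ 2 ≤ Fintype.card S / N :=
    (pow_le_pow_left₀ hμ0 (min_le_right _ _) 2).trans_eq (Real.sq_sqrt (by positivity))
  have h2 := fun s => le_sum_prod_trajProb_mul_abs hP hE ⟨0, hH⟩ s
    (by rw [hρ]; exact one_div_le_one_div_of_le two_pos hn) N hμ0 (min_le_left _ _) (by
      rw [hρ]
      refine (mul_le_mul_of_nonneg_right hμsq (by positivity)).trans_eq ?_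
      field_simp)
  have h3 := mul_le_mul_of_nonneg_left
    (Finset.sum_le_sum fun s (_ : s ∈ Finset.univ) => h2 s)
    (show (0 : ℝ) ≤ H / (4 * N) by positivity)
  have h4 : (H : ℝ) / (4 * N) * ∑ s, μ * (N * M.ρ s) / 6 = 1 / 24 * (H * μ) := by
    rw [← Finset.sum_div, ← Finset.mul_sum, ← Finset.mul_sum, M.ρ_mem.2]
    field_simp
    ring
  have h5 : min (H : ℝ) (H * Real.sqrt (Fintype.card S / N)) = H * μ := by
    rw [hμ, mul_min_of_nonneg _ _ (Nat.cast_nonneg H), mul_one]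
  rw [h5, hV, ← h4]
  linarith
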